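/- Let $H$ be a complex Hilbert space, $m\ge 2$, $P_1,\dots,P_m$ orthogonal projections on $H$, and $R_0$ a positive bounded operator on $H$ that is trace class. For finite words $w$ over $\mathcal A=\{1,\dots,m\}$ define $R_\emptyset=R_0$, $$R_{wj}=R_w^{1/2}(I-P_j)R_w^{1/2},\qquad D_{wj}=R_w^{1/2}P_jR_w^{1/2}\qquad(j\in\mathcal A),$$ and for a branch $\omega=(j_1,j_2,\dots)\in\Omega=\mathcal A^{\mathbb N}$ and $k\ge1$ put $\Delta_k(\omega)=D_{j_1\cdots j_k}$. Fix a probability vector $q=(q_1,\dots,q_m)$ with all $q_j>0$, and let $p(j\mid w)=\operatorname{tr}(D_{wj})/\sum_{i}\operatorname{tr}(D_{wi})$ if the denominator is nonzero and $p(j\mid w)=q_j$ otherwise. Let $\nu^{\mathrm{tr}}$ be the Borel probability measure on $\Omega$ that gives the cylinder of branches starting with $j_1\cdots j_n$ the mass $p(j_1\mid\emptyset)\,p(j_2\mid j_1)\cdots p(j_n\mid j_1\cdots j_{n-1})$. Assume that for some $\alpha>0$ one has $\sum_{j=1}^m P_j\ge\alpha I$ on $H_0=\overline{\operatorname{ran}}(R_0^{1/2})$,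 that is, $\langle x,\sum_jP_jx\rangle\ge\alpha\|x\|^2$ for all $x\in H_0$. Then for every $\omega\in\Omega$ and $k\ge1$ the operator $\Delta_k(\omega)$ has a spectral decomposition $\Delta_k(\omega)=\sum_{r\in\mathcal R_k}\lambda_{k,r}|u_{k,r}\rangle\langle u_{k,r}|$ (strong operator topology), with $\mathcal R_k$ at most countable, $(u_{k,r})_r$ orthonormal and $\lambda_{k,r}\ge0$. Moreover, there is a set $\Omega_0\subset\Omega$ of full $\nu^{\mathrm{tr}}$-measure such that for every $\omega\in\Omega_0$ and every choice of such decompositions, with atoms $\varphi_{k,r}=\lambda_{k,r}^{1/2}u_{k,r}$, the following hold. 1. $R_0=\sum_{k=1}^\infty\Delta_k(\omega)$ in the strong operator topology. 2. For every $x\in H$, $$\langle x,R_0x\rangle=\sum_{k=1}^\infty\langle x,\Delta_k(\omega)x\rangle=\sum_{k=1}^\infty\sum_{r\in\mathcal R_k}|\langle x,\varphi_{k,r}\rangle|^2,$$ where $\langle x,\Delta_k(\omega)x\rangle=\sum_r|\langle x,\varphi_{k,r}\rangle|^2$ for each $k$, and all terms are nonnegative, so that the double series may be summed in any order. 3. The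 family $\{\varphi_{k,r}\}$ has frame operator $R_0$, that is, $\sum_{k,r}\langle\varphi_{k,r},x\rangle\varphi_{k,r}=R_0x$ and $\sum_{k,r}|\langle x,\varphi_{k,r}\rangle|^2=\langle x,R_0x\rangle$ for every $x\in H$ (inner products are linear in the second variable), and its closed linear span is $\overline{\operatorname{ran}}(R_0^{1/2})$. In particular, if $R_0$ is the identity on a closed subspace $K\subset H$ and zero on $K^\perp$, then $\{\varphi_{k,r}\}$ is a Parseval frame for $K$: all $\varphi_{k,r}$ lie in $K$ and $\sum_{k,r}|\langle x,\varphi_{k,r}\rangle|^2=\|x\|^2$ for every $x\in K$. -/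

import Mathlib

open MeasureTheory ProbabilityTheory
open scoped ENNReal InnerProductSpace

namespace WRTree

noncomputable section

lemma parseval_ennreal {H : Type*} [NormedAddCommGroup H] [InnerProductSpace ℂ H]
    {ι : Type*} (b : HilbertBasis ι ℂ H) (x : H) :
    ∑' i, ENNReal.ofReal (‖⟪b i, x⟫_ℂ‖ ^ 2) = ENNReal.ofReal (‖x‖ ^ 2) := by
  have h := b.hasSum_inner_mul_inner x x
  have h' : HasSum (fun i => ‖⟪b i, x⟫_ℂ‖ ^ 2) (‖x‖ ^ 2) := by
    have := (RCLike.hasSum_re ℂ h)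
    convert this using 1
    · funext i
      rw [← inner_conj_symm x (b i), RCLike.conj_mul]
      norm_cast
    · rw [inner_self_eq_norm_sq]
  rw [← h'.tsum_eq, ENNReal.ofReal_tsum_of_nonneg (fun i => by positivity) h'.summable]

section Operators

variable {H : Type*} [NormedAddCommGroup H] [InnerProductSpace ℂ H] [CompleteSpace H]

/-- The trace of a positive bounded operator `T`, with values in `[0, ∞]`: the sum of the diagonal
entries `⟨e, T e⟩` over a Hilbert basis. By `posTrace_eq_tsum` the choice of basis is immaterial. -/
def posTrace (T : H →L[ℂ] H) : ℝ≥0∞ :=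
  ∑' e : (exists_hilbertBasis ℂ H).choose, ENNReal.ofReal (RCLike.re ⟪(e : H), T (e : H)⟫_ℂ)

/-- A bounded operator is trace class when the trace of its absolute value is finite. -/
def IsTraceClass (T : H →L[ℂ] H) : Prop := posTrace (CFC.abs T) ≠ ∞

/-- The trace of a positive operator may be computed in any Hilbert basis. -/
theorem posTrace_eq_tsum {ι : Type*} (b : HilbertBasis ι ℂ H) (T : H →L[ℂ] H)
    (hT : T.IsPositive) :
    posTrace T = ∑' i, ENNReal.ofReal (RCLike.re ⟪b i, T (b i)⟫_ℂ) := by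
  obtain ⟨c, hc⟩ := (exists_hilbertBasis ℂ H).choose_spec
  have hT0 : 0 ≤ T := (ContinuousLinearMap.nonneg_iff_isPositive T).2 hT
  set S : H →L[ℂ] H := CFC.sqrt T with hS
  have hSpos : S.IsPositive :=
    (ContinuousLinearMap.nonneg_iff_isPositive S).1 (CFC.sqrt_nonneg T)
  have hsym : ∀ x y : H, ⟪S x, y⟫_ℂ = ⟪x, S y⟫_ℂ := hSpos.isSymmetric
  have hmul : S * S = T := CFC.sqrt_mul_sqrt_self T hT0
  have key : ∀ x : H, RCLike.re ⟪x, T x⟫_ℂ = ‖S x‖ ^ 2 := by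
    intro x
    rw [← hmul, mul_apply_eq_comp, ← hsym, inner_self_eq_norm_sq]
  unfold posTrace
  simp only [key]
  have h1 : ∀ e : (exists_hilbertBasis ℂ H).choose,
      ENNReal.ofReal (‖S (e : H)‖ ^ 2) =
        ∑' i, ENNReal.ofReal (‖⟪b i, S (c e)⟫_ℂ‖ ^ 2) := by
    intro e
    rw [parseval_ennreal b, hc]
  have h2 : ∀ i, ENNReal.ofReal (‖S (b i)‖ ^ 2) =
        ∑' e, ENNReal.ofReal (‖⟪b i, S (c e)⟫_ℂ‖ ^ 2) := by
    intro i
    rw [← parseval_ennreal c]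
    refine tsum_congr fun e => ?_
    rw [← hsym, norm_inner_symm]
  simp only [h1, h2]
  exact ENNReal.tsum_comm

/-- The support space `H₀`, the closure of the range of `R₀^{1/2}`. -/
def supportSpace (R₀ : H →L[ℂ] H) : Submodule ℂ H :=
  (LinearMap.range (CFC.sqrt R₀ : H →L[ℂ] H).toLinearMap).topologicalClosure

/-- The weighted residual map `Φ_P(R) = R^{1/2} (I - P) R^{1/2}`. -/
def residualMap (P R : H →L[ℂ] H) : H →L[ℂ] H :=
  CFC.sqrt R * (1 - P) * CFC.sqrt R

variable {m : ℕ}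

/-- The residual operator `R_w` at the node `w` of the `m`-ary tree: start with `R₀` at the root
and apply the weighted residual maps of the successive letters of `w`. -/
def residual (P : Fin m → H →L[ℂ] H) (R₀ : H →L[ℂ] H) (w : List (Fin m)) : H →L[ℂ] H :=
  w.foldl (fun R j => residualMap (P j) R) R₀

lemma residual_nil (P : Fin m → H →L[ℂ] H) (R₀ : H →L[ℂ] H) : residual P R₀ [] = R₀ := rfl

lemma residual_append (P : Fin m → H →L[ℂ] H) (R₀ : H →L[ℂ] H) (w : List (Fin m)) (j : Fin m) :
    residual P R₀ (w ++ [j]) = residualMap (P j) (residual P R₀ w) := by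
  simp [residual]

/-- The dissipated piece `D_{wj} = R_w^{1/2} P_j R_w^{1/2}`. -/
def dissipated (P : Fin m → H →L[ℂ] H) (R₀ : H →L[ℂ] H) (w : List (Fin m)) (j : Fin m) :
    H →L[ℂ] H :=
  CFC.sqrt (residual P R₀ w) * P j * CFC.sqrt (residual P R₀ w)

/-- The finite word formed by the first `n` letters of the branch `ω`. -/
def branchPrefix (ω : ℕ → Fin m) (n : ℕ) : List (Fin m) :=
  List.ofFn fun i : Fin n => ω i

/-- The operator dissipated along the branch `ω` at its `k`-th step. Steps and letters are numbered
from `0`, so this is the operator written `Δ_{k+1}(ω)` when they are numbered from `1`. -/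
def branchDissipated (P : Fin m → H →L[ℂ] H) (R₀ : H →L[ℂ] H) (ω : ℕ → Fin m) (k : ℕ) :
    H →L[ℂ] H :=
  dissipated P R₀ (branchPrefix ω k) (ω k)

/-- A spectral decomposition `T = ∑_r λ_r |u_r⟩⟨u_r|` with at most countably many terms, converging
in the strong operator topology, with `u` orthonormal and `λ ≥ 0`. -/
structure SpectralDecomposition (T : H →L[ℂ] H) where
  index : Type
  index_countable : Countable index
  vec : index → H
  eig : index → ℝ
  vec_orthonormal : Orthonormal ℂ vec
  eig_nonneg : ∀ r, 0 ≤ eig r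
  hasSum_apply : ∀ x : H, HasSum (fun r => ((eig r : ℂ) * ⟪vec r, x⟫_ℂ) • vec r) (T x)

/-- The rank-one atom `φ_r = λ_r^{1/2} u_r`. -/
def SpectralDecomposition.atom {T : H →L[ℂ] H} (S : SpectralDecomposition T) (r : S.index) : H :=
  ((Real.sqrt (S.eig r) : ℝ) : ℂ) • S.vec r

/-- The family `φ` is a Parseval frame for the subspace `K`. -/
def IsParsevalFrame {ι : Type*} (K : Submodule ℂ H) (φ : ι → H) : Prop :=
  (∀ i, φ i ∈ K) ∧ ∀ x ∈ K, HasSum (fun i => ‖⟪x, φ i⟫_ℂ‖ ^ 2) (‖x‖ ^ 2)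

end Operators

section PathMeasure

variable {m : ℕ}

/-- The one-step kernel of the random branch: given the letters number `0, …, n`, which form a word
`w`, the next letter has law `p w`. -/
def stepKernel (p : List (Fin m) → PMF (Fin m)) (n : ℕ) :
    Kernel ((i : Finset.Iic n) → (fun _ : ℕ => Fin m) i) ((fun _ : ℕ => Fin m) (n + 1)) :=
  Kernel.ofFunOfCountable fun h =>
    (p (List.ofFn fun i : Fin (n + 1) =>
      h ⟨i, Finset.mem_Iic.2 (Nat.lt_succ_iff.1 i.2)⟩)).toMeasure

instance (p : List (Fin m) → PMF (Fin m)) (n : ℕ) : IsMarkovKernel (stepKernel p n) :=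
  ⟨fun _ => PMF.toMeasure.isProbabilityMeasure _⟩

/-- The law on branches of the random infinite word whose letter following the word `w` has
conditional law `p w`. It is the probability measure with the cylinder weights
`p(j₁ | ∅) p(j₂ | j₁) ⋯ p(j_n | j₁ ⋯ j_{n-1})`, see `pathMeasure_cylinder`. -/
def pathMeasure (p : List (Fin m) → PMF (Fin m)) : Measure (ℕ → Fin m) :=
  Kernel.trajMeasure (X := fun _ => Fin m) (p []).toMeasure (stepKernel p)

instance (p : List (Fin m) → PMF (Fin m)) : IsProbabilityMeasure (pathMeasure p) := by
  unfold pathMeasure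
  infer_instance

lemma branchPrefix_succ (ω : ℕ → Fin m) (n : ℕ) :
    branchPrefix ω (n + 1) = branchPrefix ω n ++ [ω n] := by
  rw [branchPrefix, List.ofFn_succ', List.concat_eq_append]
  rfl

lemma pathMeasure_map_zero (p : List (Fin m) → PMF (Fin m)) :
    (pathMeasure p).map (fun ω => ω 0) = (p []).toMeasure := by
  have h1 : (pathMeasure p).map (Preorder.frestrictLe (π := fun _ => Fin m) 0) =
      ((p []).toMeasure).map
        (MeasurableEquiv.piUnique (fun _ : Finset.Iic 0 => Fin m)).symm := by
    rw [pathMeasure, Kernel.trajMeasure, Measure.map_comp _ _ (by fun_prop),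
      Kernel.traj_map_frestrictLe, Kernel.partialTraj_self, Measure.id_comp]
  have h2 : (fun ω : ℕ → Fin m => ω 0) =
      (fun h : (Finset.Iic 0) → Fin m => h ⟨0, by simp⟩) ∘
        (Preorder.frestrictLe (π := fun _ => Fin m) 0) := rfl
  rw [h2, ← Measure.map_map (by fun_prop) (by fun_prop), h1,
    Measure.map_map (by fun_prop) (by fun_prop)]
  have h3 : (fun h : (Finset.Iic 0) → Fin m => h ⟨0, by simp⟩) ∘
      (MeasurableEquiv.piUnique (fun _ : Finset.Iic 0 => Fin m)).symm = id := by
    funext x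
    rfl
  rw [h3, Measure.map_id]

/-- The value of `pathMeasure p` on the cylinder `[w]` of branches starting with the word
`w = j₁ ⋯ j_n`, where `w` is given as the prefix of length `n` of some branch `v`. -/
theorem pathMeasure_cylinder (p : List (Fin m) → PMF (Fin m)) (v : ℕ → Fin m) (n : ℕ) :
    pathMeasure p {ω | branchPrefix ω n = branchPrefix v n} =
      ∏ i ∈ Finset.range n, p (branchPrefix v i) (v i) := by
  induction n with
  | zero => simp [branchPrefix]
  | succ n ih =>
    rw [Finset.prod_range_succ, ← ih]
    cases n with
    | zero =>
      have h := congrArg (fun μ => μ {v 0}) (pathMeasure_map_zero p)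
      simp only [PMF.toMeasure_apply_singleton _ _ (measurableSet_singleton _)] at h
      rw [Measure.map_apply (by fun_prop) (measurableSet_singleton _)] at h
      simp only [branchPrefix_succ]
      simpa [branchPrefix, Set.preimage] using h
    | succ a =>
      have h := Kernel.map_frestrictLe_trajMeasure_compProd_eq_map_trajMeasure
        (X := fun _ => Fin m) (μ₀ := (p []).toMeasure) (κ := stepKernel p) (a := a)
      set W : ((i : Finset.Iic a) → Fin m) → List (Fin m) := fun h =>
        List.ofFn fun i : Fin (a + 1) =>
          h ⟨i, Finset.mem_Iic.2 (Nat.lt_succ_iff.1 i.2)⟩ with hW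
      set A : Set ((i : Finset.Iic a) → Fin m) := {h | W h = branchPrefix v (a + 1)} with hA
      have hAm : MeasurableSet A := (Set.toFinite A).measurableSet
      have h' := congrArg (fun μ => μ (A ×ˢ {v (a + 1)})) h
      beta_reduce at h'
      rw [Measure.map_apply (by fun_prop) (hAm.prod (measurableSet_singleton _)),
        Measure.compProd_apply_prod hAm (measurableSet_singleton _)] at h'
      have hset : {ω | branchPrefix ω (a + 1 + 1) = branchPrefix v (a + 1 + 1)} =
          (fun ω : ℕ → Fin m =>
            (Preorder.frestrictLe (π := fun _ => Fin m) a ω, ω (a + 1))) ⁻¹'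
            (A ×ˢ {v (a + 1)}) := by
        ext ω
        simp only [branchPrefix_succ _ (a + 1), Set.mem_ofPred_eq, Set.mem_preimage, Set.mem_prod,
          Set.mem_singleton_iff]
        have hl : (branchPrefix ω (a + 1)).length = (branchPrefix v (a + 1)).length := by
          simp [branchPrefix]
        constructor
        · intro e
          obtain ⟨e1, e2⟩ := List.append_inj e hl
          exact ⟨e1, by simpa using e2⟩
        · rintro ⟨e1, e2⟩
          have e1' : branchPrefix ω (a + 1) = branchPrefix v (a + 1) := e1
          rw [e1', e2]
      have hset2 : {ω | branchPrefix ω (a + 1) = branchPrefix v (a + 1)} =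
          (Preorder.frestrictLe (π := fun _ => Fin m) a) ⁻¹' A := rfl
      rw [hset, pathMeasure, ← h', hset2,
        ← Measure.map_apply (by fun_prop) hAm]
      rw [setLIntegral_congr_fun (g := fun _ => p (branchPrefix v (a + 1)) (v (a + 1))) hAm]
      · rw [setLIntegral_const, mul_comm]
      · intro x hx
        have hx' : W x = branchPrefix v (a + 1) := hx
        have : stepKernel p a x = (p (W x)).toMeasure := rfl
        simp only [this, hx', PMF.toMeasure_apply_singleton _ _ (measurableSet_singleton _)]

end PathMeasure

section TraceBiased

variable {H : Type*} [NormedAddCommGroup H] [InnerProductSpace ℂ H] [CompleteSpace H] {m : ℕ}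

open Classical in
/-- The trace-biased transition probabilities: from the node `w`, the letter `j` is chosen with
probability `tr D_{wj} / ∑_k tr D_{wk}` if this denominator is nonzero, and with the reference
probability `q j` otherwise. (The denominator is finite when `R₀` is trace class.) -/
def traceTransition (P : Fin m → H →L[ℂ] H) (R₀ : H →L[ℂ] H) (q : PMF (Fin m))
    (w : List (Fin m)) : PMF (Fin m) :=
  if h : ∑' j, posTrace (dissipated P R₀ w j) ≠ 0 ∧
      ∑' j, posTrace (dissipated P R₀ w j) ≠ ∞ then
    PMF.normalize (fun j => posTrace (dissipated P R₀ w j)) h.1 h.2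
  else q

/-- The trace-biased path measure on the space of branches. -/
def traceMeasure (P : Fin m → H →L[ℂ] H) (R₀ : H →L[ℂ] H) (q : PMF (Fin m)) :
    Measure (ℕ → Fin m) :=
  pathMeasure (traceTransition P R₀ q)

end TraceBiased

end

end WRTree

open MeasureTheory ProbabilityTheory
open scoped ENNReal InnerProductSpace

namespace WRTree

noncomputable section

/-! ### Square roots, traces and spectral decompositions of positive operators. -/

section PositiveOperators

variable {H : Type*} [NormedAddCommGroup H] [InnerProductSpace ℂ H] [CompleteSpace H]

/-! The identity R_{wj} + D_{wj} = R_w telescopes along a branch: the first n operators Δ_k sum to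
R_0 minus the residual after n letters. Everything therefore rests on the residuals tending strongly
to 0 almost surely.

Progress is measured by the trace. Put t = tr R_w, d_j = tr D_{wj} and s = ∑ d_j. A trace-biased
letter leaves on average t - ∑ d_j²/s, which is at most t - s/m by Cauchy–Schwarz. Since R_w ≤ R_0,
the range of R_w^{1/2} lies in H_0, so the lower bound on ∑ P_j gives s ≥ αt. The trace thus
contracts in conditional mean by 1 - α/m (`sum_traceTransition_mul_posTrace_le`). The expected
traces are then summable, and the traces vanish along almost every branch
(`ae_tendsto_zero_of_contraction`). As ‖T‖ ≤ tr T, one null set serves all vectors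
(`ae_tendsto_residual_apply`).

The rest is deterministic. Finite trace forces compactness, hence `nonempty_spectralDecomposition`.
Positivity makes the scalar double series order-independent, and a Bessel bound lifts this to
unconditional convergence of the vector series (`hasSum_inner_atom_smul_atom`). -/

lemma sqrt_isPositive (T : H →L[ℂ] H) : (CFC.sqrt T).IsPositive :=
  (ContinuousLinearMap.nonneg_iff_isPositive _).1 (CFC.sqrt_nonneg T)

lemma inner_sqrt_left (T : H →L[ℂ] H) (x y : H) : ⟪CFC.sqrt T x, y⟫_ℂ = ⟪x, CFC.sqrt T y⟫_ℂ :=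
  (sqrt_isPositive T).isSymmetric x y

lemma sqrt_sqrt_apply {T : H →L[ℂ] H} (hT : T.IsPositive) (x : H) :
    CFC.sqrt T (CFC.sqrt T x) = T x := by
  have h := CFC.sqrt_mul_sqrt_self T ((ContinuousLinearMap.nonneg_iff_isPositive T).2 hT)
  exact congrArg (fun A : H →L[ℂ] H => A x) h

lemma re_inner_eq_norm_sqrt_sq {T : H →L[ℂ] H} (hT : T.IsPositive) (x : H) :
    RCLike.re ⟪x, T x⟫_ℂ = ‖CFC.sqrt T x‖ ^ 2 := by
  rw [← sqrt_sqrt_apply hT, ← inner_sqrt_left, inner_self_eq_norm_sq]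

lemma inner_eq_re {T : H →L[ℂ] H} (hT : T.IsPositive) (x : H) :
    ⟪x, T x⟫_ℂ = ((RCLike.re ⟪x, T x⟫_ℂ : ℝ) : ℂ) := by
  rw [re_inner_eq_norm_sqrt_sq hT, ← sqrt_sqrt_apply hT, ← inner_sqrt_left,
    inner_self_eq_norm_sq_to_K]
  norm_cast

lemma isPositive_sqrt_conj (R : H →L[ℂ] H) {A : H →L[ℂ] H} (hA : A.IsPositive) :
    (CFC.sqrt R * A * CFC.sqrt R).IsPositive := by
  have h := hA.conj_adjoint (CFC.sqrt R)
  rwa [(sqrt_isPositive R).isSelfAdjoint.adjoint_eq] at h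

lemma IsTraceClass.posTrace_ne_top {T : H →L[ℂ] H} (hT : T.IsPositive) (h : IsTraceClass T) :
    posTrace T ≠ ∞ := by
  rwa [IsTraceClass, CFC.abs_of_nonneg T ((ContinuousLinearMap.nonneg_iff_isPositive T).2 hT)] at h

lemma posTrace_add {A B : H →L[ℂ] H} (hA : A.IsPositive) (hB : B.IsPositive) :
    posTrace (A + B) = posTrace A + posTrace B := by
  rw [posTrace, posTrace, posTrace, ← ENNReal.tsum_add]
  refine tsum_congr fun e => ?_
  rw [← ENNReal.ofReal_add (hA.re_inner_nonneg_right _) (hB.re_inner_nonneg_right _),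
    ← map_add, ← inner_add_right]
  rfl

lemma posTrace_sum {ι : Type*} [Fintype ι] {A : ι → H →L[ℂ] H} (hA : ∀ i, (A i).IsPositive) :
    posTrace (∑ i, A i) = ∑ i, posTrace (A i) := by
  simp only [posTrace]
  rw [← Summable.tsum_finsetSum fun _ _ => ENNReal.summable]
  refine tsum_congr fun e => ?_
  rw [← ENNReal.ofReal_sum_of_nonneg fun i _ => (hA i).re_inner_nonneg_right _, ← map_sum,
    ← inner_sum, sum_apply]

/-- Comparison of traces from a comparison of quadratic forms. -/
lemma ofReal_mul_posTrace_le {A B : H →L[ℂ] H} {c : ℝ} (hc : 0 ≤ c)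
    (h : ∀ x, c * RCLike.re ⟪x, A x⟫_ℂ ≤ RCLike.re ⟪x, B x⟫_ℂ) :
    ENNReal.ofReal c * posTrace A ≤ posTrace B := by
  rw [posTrace, posTrace, ← ENNReal.tsum_mul_left]
  refine ENNReal.tsum_le_tsum fun e => ?_
  rw [← ENNReal.ofReal_mul hc]
  exact ENNReal.ofReal_le_ofReal (h _)

/-- The coordinates of `T^{1/2} x` along a family of vectors are controlled by the diagonal entries
of `T` along the same family. -/
lemma tsum_inner_sqrt_le {ι : Type*} (b : ι → H) (T : H →L[ℂ] H) (hT : T.IsPositive) (x : H) :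
    ∑' i, ENNReal.ofReal (‖⟪b i, CFC.sqrt T x⟫_ℂ‖ ^ 2) ≤
      (∑' i, ENNReal.ofReal (RCLike.re ⟪b i, T (b i)⟫_ℂ)) * ENNReal.ofReal (‖x‖ ^ 2) := by
  rw [← ENNReal.tsum_mul_right]
  refine ENNReal.tsum_le_tsum fun i => ?_
  rw [← ENNReal.ofReal_mul (hT.re_inner_nonneg_right _), re_inner_eq_norm_sqrt_sq hT, ← mul_pow,
    ← inner_sqrt_left]
  gcongr
  exact norm_inner_le_norm _ _

lemma ofReal_re_inner_le_posTrace {T : H →L[ℂ] H} (hT : T.IsPositive) (x : H) :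
    ENNReal.ofReal (RCLike.re ⟪x, T x⟫_ℂ) ≤ posTrace T * ENNReal.ofReal (‖x‖ ^ 2) := by
  obtain ⟨w, b, -⟩ := exists_hilbertBasis ℂ H
  rw [posTrace_eq_tsum b T hT, re_inner_eq_norm_sqrt_sq hT, ← parseval_ennreal b]
  exact tsum_inner_sqrt_le b T hT x

/-- A positive operator of finite trace has a compact square root. -/
lemma isCompactOperator_sqrt {T : H →L[ℂ] H} (hT : T.IsPositive) (h : posTrace T ≠ ∞) :
    IsCompactOperator (CFC.sqrt T : H →L[ℂ] H) := by
  obtain ⟨w, b, -⟩ := exists_hilbertBasis ℂ H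
  classical
  set S := CFC.sqrt T with hS
  -- Finite-rank truncations of `S`: its output is projected onto the span of the `b i` with `i ∈
  -- s`.
  let F : Finset w → H →L[ℂ] H := fun s =>
    (∑ i ∈ s, (innerSL ℂ (b i)).smulRight (b i)) ∘L S
  have hF : ∀ s x, F s x = ∑ i ∈ s, ⟪b i, S x⟫_ℂ • b i := by
    intro s x
    simp [F]
  have hcompact : ∀ s, IsCompactOperator (F s) := by
    intro s
    have h1 : IsCompactOperator
        (∑ i ∈ s, (innerSL ℂ (b i)).smulRight (b i) : H →L[ℂ] H) := by
      refine (compactOperator (RingHom.id ℂ) H H).sum_mem fun i _ => ?_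
      change IsCompactOperator (fun x => ⟪b i, x⟫_ℂ • b i)
      have : IsCompactOperator (innerSL ℂ (b i)) :=
        isCompactOperator_of_locallyCompactSpace_dom _
      exact this.clm_comp (ContinuousLinearMap.toSpanSingleton ℂ (b i))
    exact h1.comp_clm S
  refine isCompactOperator_of_tendsto (F := F) (f := S) (l := Filter.atTop) ?_
    (Filter.Eventually.of_forall hcompact)
  have hsum : ∑' i, ENNReal.ofReal (RCLike.re ⟪b i, T (b i)⟫_ℂ) ≠ ∞ := by
    rwa [← posTrace_eq_tsum b T hT]
  have htail := ENNReal.tendsto_tsum_compl_atTop_zero hsum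
  -- The coordinates lost in `F s` are ⟨b i, S x⟩ = ⟨S (b i), x⟩ with `i ∉ s`, so the squared norm
  -- error is at most a tail of the trace series.
  have hbound : ∀ s : Finset w, ENNReal.ofReal (‖F s - S‖ ^ 2) ≤
      ∑' i : {i // i ∉ s}, ENNReal.ofReal (RCLike.re ⟪b i, T (b i)⟫_ℂ) := by
    intro s
    set t := ∑' i : {i // i ∉ s}, ENNReal.ofReal (RCLike.re ⟪b i, T (b i)⟫_ℂ) with ht
    have ht' : t ≠ ∞ := ne_top_of_le_ne_top hsum
      (ENNReal.tsum_comp_le_tsum_of_injective Subtype.val_injective _)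
    suffices hh : ‖F s - S‖ ≤ Real.sqrt t.toReal by
      rw [← ENNReal.ofReal_toReal ht']
      refine ENNReal.ofReal_le_ofReal ?_
      calc ‖F s - S‖ ^ 2 ≤ Real.sqrt t.toReal ^ 2 := by gcongr
        _ = _ := Real.sq_sqrt ENNReal.toReal_nonneg
    refine ContinuousLinearMap.opNorm_le_bound _ (Real.sqrt_nonneg _) fun x => ?_
    refine abs_le_of_sq_le_sq' ?_ (by positivity) |>.2
    rw [mul_pow, Real.sq_sqrt ENNReal.toReal_nonneg]
    have hcoord : ∀ i, ⟪b i, (F s - S) x⟫_ℂ = if i ∈ s then 0 else - ⟪b i, S x⟫_ℂ := by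
      intro i
      rw [sub_apply, inner_sub_right, hF, inner_sum]
      simp only [inner_smul_right, orthonormal_iff_ite.1 b.orthonormal]
      split_ifs with hi <;> simp [hi]
    have h2 : ENNReal.ofReal (‖(F s - S) x‖ ^ 2) ≤ t * ENNReal.ofReal (‖x‖ ^ 2) := by
      rw [← parseval_ennreal b]
      refine le_trans (le_of_eq ?_) (tsum_inner_sqrt_le (fun i : {i // i ∉ s} => b i) T hT x)
      refine Eq.trans ?_ (tsum_subtype {i | i ∉ s}
        (fun i => ENNReal.ofReal (‖⟪b i, CFC.sqrt T x⟫_ℂ‖ ^ 2))).symm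
      refine tsum_congr fun i => ?_
      rw [hcoord]
      by_cases hi : i ∈ s <;> simp [hi, Set.indicator, hS]
    rw [← ENNReal.ofReal_toReal ht', ← ENNReal.ofReal_mul ENNReal.toReal_nonneg] at h2
    exact (ENNReal.ofReal_le_ofReal_iff (by positivity)).1 h2
  have h3 : Filter.Tendsto (fun s => ENNReal.ofReal (‖F s - S‖ ^ 2)) Filter.atTop (nhds 0) :=
    tendsto_of_tendsto_of_tendsto_of_le_of_le tendsto_const_nhds htail (fun _ => zero_le) hbound
  rw [tendsto_iff_norm_sub_tendsto_zero]
  have h4 := (ENNReal.tendsto_toReal ENNReal.zero_ne_top).comp h3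
  have h5 := (Real.continuous_sqrt.tendsto _).comp h4
  simpa [Function.comp_def] using h5

lemma isCompactOperator_of_posTrace_ne_top {T : H →L[ℂ] H} (hT : T.IsPositive)
    (h : posTrace T ≠ ∞) : IsCompactOperator T := by
  have h1 := (isCompactOperator_sqrt hT h).comp_clm (CFC.sqrt T)
  exact (funext fun x => sqrt_sqrt_apply hT x :
    (CFC.sqrt T : H →L[ℂ] H) ∘ (CFC.sqrt T : H →L[ℂ] H) = T) ▸ h1

/-- A compact positive operator has a Hilbert basis of eigenvectors. -/
lemma exists_hilbertBasis_eigenvectors.{u} {H : Type u} [NormedAddCommGroup H]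
    [InnerProductSpace ℂ H] [CompleteSpace H] {T : H →L[ℂ] H} (hT : T.IsPositive)
    (hc : IsCompactOperator T) :
    ∃ (ι : Type u) (b : HilbertBasis ι ℂ H) (μ : ι → ℂ), ∀ i, T (b i) = μ i • b i := by
  have hfam := LinearMap.IsSymmetric.orthogonalFamily_eigenspaces hT.isSymmetric
  have hbot := ContinuousLinearMap.orthogonalComplement_iSup_eigenspaces_eq_bot hc hT.isSymmetric
  have hclosed : ∀ μ : ℂ, IsClosed (Module.End.eigenspace T.toLinearMap μ : Set H) := by
    intro μ
    have : (Module.End.eigenspace T.toLinearMap μ : Set H) = {x | T x = μ • x} := by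
      ext x
      simp
    rw [this]
    exact isClosed_eq T.continuous (continuous_const_smul μ)
  have hcomplete : ∀ μ : ℂ, CompleteSpace (Module.End.eigenspace T.toLinearMap μ) :=
    fun μ => (hclosed μ).completeSpace_coe
  choose w b hb using fun μ : ℂ => exists_hilbertBasis ℂ (Module.End.eigenspace T.toLinearMap μ)
  have hon := hfam.orthonormal_sigma_orthonormal fun μ => (b μ).orthonormal
  refine ⟨Σ μ : ℂ, w μ, HilbertBasis.mkOfOrthogonalEqBot hon ?_, fun i => i.1, fun i => ?_⟩
  -- A vector orthogonal to the chosen eigenvectors is orthogonal to each whole eigenspace, by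
  -- expansion in that eigenspace's basis; the spectral theorem then makes it zero.
  · rw [eq_bot_iff, ← hbot]
    intro x hx
    rw [Submodule.mem_orthogonal] at hx
    rw [← Submodule.iInf_orthogonal, Submodule.mem_iInf]
    intro μ
    rw [Submodule.mem_orthogonal]
    intro u hu
    have h1 := ((b μ).hasSum_repr ⟨u, hu⟩).mapL
      (Module.End.eigenspace T.toLinearMap μ).subtypeL
    have h2 := h1.mapL (innerSL ℂ x)
    have h3 : ⟪x, u⟫_ℂ = 0 := by
      refine h2.unique ?_
      convert hasSum_zero with i
      have h4 := hx _ (Submodule.subset_span ⟨⟨μ, i⟩, rfl⟩)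
      have h5 := inner_eq_zero_symm.1 h4
      simpa using Or.inr h5
    exact inner_eq_zero_symm.1 h3
  · rw [HilbertBasis.coe_mkOfOrthogonalEqBot]
    exact Module.End.mem_eigenspace_iff.1 (b i.1 i.2).2

theorem nonempty_spectralDecomposition {T : H →L[ℂ] H} (hT : T.IsPositive)
    (h : posTrace T ≠ ∞) : Nonempty (SpectralDecomposition T) := by
  obtain ⟨ι, b, μ, hb⟩ :=
    exists_hilbertBasis_eigenvectors hT (isCompactOperator_of_posTrace_ne_top hT h)
  have hμ : ∀ i, ⟪b i, T (b i)⟫_ℂ = μ i := by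
    intro i
    rw [hb, inner_smul_right, inner_self_eq_norm_sq_to_K, b.orthonormal.1 i]
    simp
  have hre : ∀ i, μ i = (((μ i).re : ℝ) : ℂ) := by
    intro i
    have := inner_eq_re hT (b i)
    rwa [hμ] at this
  have hnn : ∀ i, 0 ≤ (μ i).re := by
    intro i
    have := hT.re_inner_nonneg_right (b i)
    rwa [hμ] at this
  -- In the eigenbasis the trace is the sum of the eigenvalues, and a finite sum in [0, ∞] has
  -- countable support.
  have hcount : {i | μ i ≠ 0}.Countable := by
    rw [posTrace_eq_tsum b T hT] at h
    refine (Summable.countable_support_ennreal h).mono fun i hi => ?_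
    have : 0 < (μ i).re := lt_of_le_of_ne (hnn i) fun h0 => hi (by rw [hre i, ← h0]; simp)
    simpa [hμ] using this
  have : Countable {i | μ i ≠ 0} := hcount
  -- The basis is indexed in the universe of `H`, but a `SpectralDecomposition` needs an index in
  -- `Type`; a subset of ℕ serves.
  obtain ⟨f, hf⟩ := Countable.exists_injective_nat {i | μ i ≠ 0}
  let e : {i | μ i ≠ 0} ≃ Set.range f := Equiv.ofInjective f hf
  refine ⟨⟨Set.range f, inferInstance, fun r => b (e.symm r), fun r => (μ (e.symm r)).re,
    b.orthonormal.comp _ (Subtype.val_injective.comp e.symm.injective), fun r => hnn _, ?_⟩⟩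
  intro x
  have h1 := (b.hasSum_repr x).mapL T
  have h2 : HasSum (fun i => (μ i * ⟪b i, x⟫_ℂ) • b i) (T x) := by
    convert h1 using 2 with i
    rw [map_smul, hb, smul_smul, mul_comm, b.repr_apply_apply]
  have h3 : HasSum (fun i : {i | μ i ≠ 0} => (μ i * ⟪b i, x⟫_ℂ) • b i) (T x) := by
    refine (hasSum_subtype_iff_of_support_subset ?_).2 h2
    intro i hi h0
    exact hi (by simp [h0])
  have h4 := (e.symm.hasSum_iff (a := T x)).2 h3
  convert h4 using 2 with r
  simp only [Function.comp]
  rw [← hre]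

end PositiveOperators

/-! ### One-step recursion for the path measure and almost sure decay. -/

section PathMeasureRecursion

variable {m : ℕ}

lemma branchPrefix_length (ω : ℕ → Fin m) (n : ℕ) : (branchPrefix ω n).length = n := by
  simp [branchPrefix]

lemma measurable_comp_branchPrefix {β : Type*} [MeasurableSpace β] (n : ℕ) (f : List (Fin m) → β) :
    Measurable fun ω : ℕ → Fin m => f (branchPrefix ω n) :=
  (Measurable.of_discrete (f := fun v : Fin n → Fin m => f (List.ofFn v))).comp
    (measurable_pi_lambda _ fun i => measurable_pi_apply (i : ℕ))

/-- The letter following the word `w` has conditional law `p w`. -/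
lemma pathMeasure_prefix_letter (p : List (Fin m) → PMF (Fin m)) (n : ℕ) (w : List (Fin m))
    (j : Fin m) :
    pathMeasure p {ω | branchPrefix ω n = w ∧ ω n = j} =
      pathMeasure p {ω | branchPrefix ω n = w} * p w j := by
  by_cases hw : w.length = n
  -- Padding `w` with `j` gives a branch whose prefix of length `n + 1` is `w ++ [j]`, so the
  -- cylinder formula applies at `n` and at `n + 1`.
  · let v : ℕ → Fin m := fun i => w.getD i j
    have hv : branchPrefix v n = w := by
      subst hw
      refine List.ext_getElem (branchPrefix_length _ _) fun i h1 h2 => ?_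
      simp [branchPrefix, v]
    have hvn : v n = j := by simp [v, hw]
    have h := pathMeasure_cylinder p v (n + 1)
    rw [Finset.prod_range_succ, ← pathMeasure_cylinder p v n, hv, hvn] at h
    rw [← h]
    congr 1
    ext ω
    simp only [branchPrefix_succ, hv, hvn, Set.mem_ofPred_eq]
    constructor
    · rintro ⟨rfl, rfl⟩; rfl
    · intro e
      obtain ⟨e1, e2⟩ := List.append_inj e (by rw [branchPrefix_length, hw])
      exact ⟨e1, by simpa using e2⟩
  · have : ∀ ω, branchPrefix ω n ≠ w := fun ω e => hw (e ▸ branchPrefix_length ω n)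
    simp [this]

/-- One-step disintegration of the path measure. -/
lemma lintegral_branchPrefix_succ (p : List (Fin m) → PMF (Fin m)) (n : ℕ)
    (f : List (Fin m) → ℝ≥0∞) :
    ∫⁻ ω, f (branchPrefix ω (n + 1)) ∂(pathMeasure p) =
      ∫⁻ ω, ∑ j, p (branchPrefix ω n) j * f (branchPrefix ω n ++ [j]) ∂(pathMeasure p) := by
  -- Words form a countable set; with the discrete σ-algebra both integrals become sums over words.
  let : MeasurableSpace (List (Fin m)) := ⊤
  have hX : Measurable fun ω : ℕ → Fin m => branchPrefix ω n :=
    measurable_comp_branchPrefix n id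
  have hY : Measurable fun ω : ℕ → Fin m => (branchPrefix ω n, ω n) :=
    hX.prodMk (measurable_pi_apply n)
  have h1 : ∫⁻ ω, f (branchPrefix ω (n + 1)) ∂(pathMeasure p) =
      ∫⁻ z : List (Fin m) × Fin m, f (z.1 ++ [z.2])
        ∂((pathMeasure p).map fun ω => (branchPrefix ω n, ω n)) := by
    rw [lintegral_map Measurable.of_discrete hY]
    simp only [branchPrefix_succ]
  have h2 : ∫⁻ ω, ∑ j, p (branchPrefix ω n) j * f (branchPrefix ω n ++ [j]) ∂(pathMeasure p) =
      ∫⁻ w, ∑ j, p w j * f (w ++ [j]) ∂((pathMeasure p).map fun ω => branchPrefix ω n) := by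
    rw [lintegral_map Measurable.of_discrete hX]
  rw [h1, h2, lintegral_countable', lintegral_countable', ENNReal.tsum_prod']
  refine tsum_congr fun w => ?_
  rw [tsum_fintype, Finset.sum_mul]
  refine Finset.sum_congr rfl fun j _ => ?_
  rw [Measure.map_apply hY (measurableSet_singleton _),
    Measure.map_apply hX (measurableSet_singleton _)]
  have := pathMeasure_prefix_letter p n w j
  have e1 : (fun ω : ℕ → Fin m => (branchPrefix ω n, ω n)) ⁻¹' {(w, j)} =
      {ω | branchPrefix ω n = w ∧ ω n = j} := by
    ext ω; simp
  have e2 : (fun ω : ℕ → Fin m => branchPrefix ω n) ⁻¹' {w} = {ω | branchPrefix ω n = w} := rfl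
  rw [e1, e2, this]
  ring

/-- A functional of the word that contracts in conditional mean vanishes along almost every
branch. -/
theorem ae_tendsto_zero_of_contraction (p : List (Fin m) → PMF (Fin m)) (f : List (Fin m) → ℝ≥0∞)
    (hf : f [] ≠ ∞) {c : ℝ≥0∞} (hc : c < 1)
    (h : ∀ w, ∑ j, p w j * f (w ++ [j]) ≤ c * f w) :
    ∀ᵐ ω ∂(pathMeasure p),
      Filter.Tendsto (fun n => f (branchPrefix ω n)) Filter.atTop (nhds 0) := by
  have hn : ∀ n, ∫⁻ ω, f (branchPrefix ω n) ∂(pathMeasure p) ≤ c ^ n * f [] := by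
    intro n
    induction n with
    | zero => simp [branchPrefix]
    | succ n ih =>
      rw [lintegral_branchPrefix_succ]
      calc _ ≤ ∫⁻ ω, c * f (branchPrefix ω n) ∂(pathMeasure p) := lintegral_mono fun ω => h _
        _ = c * ∫⁻ ω, f (branchPrefix ω n) ∂(pathMeasure p) :=
          lintegral_const_mul _ (measurable_comp_branchPrefix n f)
        _ ≤ c * (c ^ n * f []) := by gcongr
        _ = c ^ (n + 1) * f [] := by ring
  -- The expected sum is dominated by a geometric series, so the sum itself is finite almost surely
  -- and its terms tend to 0.
  have hsum : ∫⁻ ω, ∑' n, f (branchPrefix ω n) ∂(pathMeasure p) ≠ ∞ := by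
    rw [lintegral_tsum fun n => (measurable_comp_branchPrefix n f).aemeasurable]
    refine ne_top_of_le_ne_top ?_ (ENNReal.tsum_le_tsum hn)
    rw [ENNReal.tsum_mul_right, ENNReal.tsum_geometric]
    refine ENNReal.mul_ne_top (ENNReal.inv_ne_top.2 ?_) hf
    exact (tsub_pos_of_lt hc).ne'
  have hae := ae_lt_top (Measurable.tsum fun n => measurable_comp_branchPrefix n f) hsum
  filter_upwards [hae] with ω hω
  exact ENNReal.tendsto_atTop_zero_of_tsum_ne_top hω.ne

end PathMeasureRecursion

/-! ### Decay of the residual operators along a random branch. -/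

section Residuals

variable {H : Type*} [NormedAddCommGroup H] [InnerProductSpace ℂ H] [CompleteSpace H] {m : ℕ}

/-- Evaluating the trace as a sum of ‖T^{1/2} e‖² gives ‖T^{1/2}‖² ≤ tr T; the square root is then
applied twice. -/
lemma norm_apply_le_posTrace {T : H →L[ℂ] H} (hT : T.IsPositive) (h : posTrace T ≠ ∞) (x : H) :
    ‖T x‖ ≤ (posTrace T).toReal * ‖x‖ := by
  have key : ∀ y, ‖CFC.sqrt T y‖ ≤ Real.sqrt (posTrace T).toReal * ‖y‖ := by
    intro y
    refine (abs_le_of_sq_le_sq' ?_ (by positivity)).2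
    have h1 := ofReal_re_inner_le_posTrace hT y
    rw [re_inner_eq_norm_sqrt_sq hT, ← ENNReal.ofReal_toReal h,
      ← ENNReal.ofReal_mul ENNReal.toReal_nonneg] at h1
    rw [mul_pow, Real.sq_sqrt ENNReal.toReal_nonneg]
    exact (ENNReal.ofReal_le_ofReal_iff (by positivity)).1 h1
  rw [← sqrt_sqrt_apply hT]
  calc _ ≤ Real.sqrt (posTrace T).toReal * ‖CFC.sqrt T x‖ := key _
    _ ≤ Real.sqrt (posTrace T).toReal * (Real.sqrt (posTrace T).toReal * ‖x‖) := by
      gcongr; exact key x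
    _ = _ := by rw [← mul_assoc, Real.mul_self_sqrt ENNReal.toReal_nonneg]

variable {P : Fin m → H →L[ℂ] H} {R₀ : H →L[ℂ] H}

lemma residual_isPositive (hP : ∀ j, IsStarProjection (P j)) (hR₀ : R₀.IsPositive)
    (w : List (Fin m)) : (residual P R₀ w).IsPositive := by
  induction w using List.reverseRecOn with
  | nil => exact hR₀
  | append_singleton w j _ =>
    rw [residual_append]
    exact isPositive_sqrt_conj _
      (ContinuousLinearMap.IsPositive.of_isStarProjection (hP j).one_sub)

lemma dissipated_isPositive (hP : ∀ j, IsStarProjection (P j)) (w : List (Fin m)) (j : Fin m) :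
    (dissipated P R₀ w j).IsPositive :=
  isPositive_sqrt_conj _ (ContinuousLinearMap.IsPositive.of_isStarProjection (hP j))

lemma residual_append_add_dissipated (hP : ∀ j, IsStarProjection (P j)) (hR₀ : R₀.IsPositive)
    (w : List (Fin m)) (j : Fin m) :
    residual P R₀ (w ++ [j]) + dissipated P R₀ w j = residual P R₀ w := by
  have h := CFC.sqrt_mul_sqrt_self (residual P R₀ w)
    ((ContinuousLinearMap.nonneg_iff_isPositive _).2 (residual_isPositive hP hR₀ w))
  rw [residual_append, residualMap, dissipated, ← add_mul, ← mul_add, sub_add_cancel, mul_one, h]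

lemma re_inner_residual_le (hP : ∀ j, IsStarProjection (P j)) (hR₀ : R₀.IsPositive)
    (w : List (Fin m)) (x : H) :
    RCLike.re ⟪x, residual P R₀ w x⟫_ℂ ≤ RCLike.re ⟪x, R₀ x⟫_ℂ := by
  induction w using List.reverseRecOn with
  | nil => exact le_rfl
  | append_singleton w j ih =>
    refine le_trans ?_ ih
    rw [← residual_append_add_dissipated hP hR₀ w j, add_apply, inner_add_right, map_add]
    exact le_add_of_nonneg_right ((dissipated_isPositive hP w j).re_inner_nonneg_right x)

/-- The orthogonal complement of the support space is the kernel of the quadratic form. -/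
lemma mem_supportSpace_orthogonal_iff (hR₀ : R₀.IsPositive) (y : H) :
    y ∈ (supportSpace R₀)ᗮ ↔ RCLike.re ⟪y, R₀ y⟫_ℂ = 0 := by
  rw [supportSpace, Submodule.orthogonal_closure, re_inner_eq_norm_sqrt_sq hR₀,
    Submodule.mem_orthogonal]
  constructor
  · intro h
    have h1 := h _ ⟨CFC.sqrt R₀ y, rfl⟩
    have h2 : ⟪CFC.sqrt R₀ (CFC.sqrt R₀ y), y⟫_ℂ = 0 := h1
    rw [inner_sqrt_left, inner_self_eq_zero] at h2
    simp [h2]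
  · rintro h _ ⟨x, rfl⟩
    have h1 : CFC.sqrt R₀ y = 0 := by simpa using h
    change ⟪CFC.sqrt R₀ x, y⟫_ℂ = 0
    rw [inner_sqrt_left, h1, inner_zero_right]

lemma supportSpace_orthogonal_orthogonal (R₀ : H →L[ℂ] H) :
    (supportSpace R₀)ᗮᗮ = supportSpace R₀ := by
  rw [Submodule.orthogonal_orthogonal_eq_closure]
  exact (Submodule.isClosed_topologicalClosure _).submodule_topologicalClosure_eq

/-- Since R_w ≤ R_0, a vector on which the form of R_0 vanishes is killed by R_w^{1/2};
self-adjointness and double complements finish. This allows the bound assumed only on H_0 to be used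
at every node. -/
lemma sqrt_residual_mem_supportSpace (hP : ∀ j, IsStarProjection (P j)) (hR₀ : R₀.IsPositive)
    (w : List (Fin m)) (x : H) : CFC.sqrt (residual P R₀ w) x ∈ supportSpace R₀ := by
  rw [← supportSpace_orthogonal_orthogonal, Submodule.mem_orthogonal]
  intro y hy
  rw [mem_supportSpace_orthogonal_iff hR₀] at hy
  have h1 := re_inner_residual_le hP hR₀ w y
  rw [hy, re_inner_eq_norm_sqrt_sq (residual_isPositive hP hR₀ w)] at h1
  have h2 : CFC.sqrt (residual P R₀ w) y = 0 := by
    rw [← norm_eq_zero]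
    exact pow_eq_zero_iff two_ne_zero |>.1 (le_antisymm h1 (by positivity))
  rw [← inner_sqrt_left, h2, inner_zero_left]

lemma posTrace_residual_append (hP : ∀ j, IsStarProjection (P j)) (hR₀ : R₀.IsPositive)
    (w : List (Fin m)) (j : Fin m) :
    posTrace (residual P R₀ (w ++ [j])) + posTrace (dissipated P R₀ w j) =
      posTrace (residual P R₀ w) := by
  rw [← posTrace_add (residual_isPositive hP hR₀ _) (dissipated_isPositive hP w j),
    residual_append_add_dissipated hP hR₀]

lemma posTrace_residual_ne_top (hP : ∀ j, IsStarProjection (P j)) (hR₀ : R₀.IsPositive)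
    (htr : posTrace R₀ ≠ ∞) (w : List (Fin m)) : posTrace (residual P R₀ w) ≠ ∞ := by
  induction w using List.reverseRecOn with
  | nil => exact htr
  | append_singleton w j ih =>
    rw [← posTrace_residual_append hP hR₀ w j] at ih
    exact ne_top_of_le_ne_top ih le_self_add

lemma posTrace_dissipated_ne_top (hP : ∀ j, IsStarProjection (P j)) (hR₀ : R₀.IsPositive)
    (htr : posTrace R₀ ≠ ∞) (w : List (Fin m)) (j : Fin m) :
    posTrace (dissipated P R₀ w j) ≠ ∞ := by
  have h := posTrace_residual_ne_top hP hR₀ htr w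
  rw [← posTrace_residual_append hP hR₀ w j] at h
  exact ne_top_of_le_ne_top h le_add_self

/-- The leakage bound: a fixed fraction of the trace is dissipated in total over all letters. -/
lemma ofReal_mul_posTrace_residual_le (hP : ∀ j, IsStarProjection (P j)) (hR₀ : R₀.IsPositive)
    {α : ℝ} (hα : 0 ≤ α)
    (hleak : ∀ x ∈ supportSpace R₀, α * ‖x‖ ^ 2 ≤ RCLike.re ⟪x, (∑ j, P j) x⟫_ℂ)
    (w : List (Fin m)) :
    ENNReal.ofReal α * posTrace (residual P R₀ w) ≤ ∑ j, posTrace (dissipated P R₀ w j) := by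
  rw [← posTrace_sum fun j => dissipated_isPositive hP w j]
  refine ofReal_mul_posTrace_le hα fun x => ?_
  have h := hleak _ (sqrt_residual_mem_supportSpace hP hR₀ w x)
  rw [re_inner_eq_norm_sqrt_sq (residual_isPositive hP hR₀ w)]
  have e : ∑ j, dissipated P R₀ w j =
      CFC.sqrt (residual P R₀ w) * (∑ j, P j) * CFC.sqrt (residual P R₀ w) := by
    simp only [dissipated, Finset.mul_sum, Finset.sum_mul]
  rw [e, mul_apply_eq_comp, mul_apply_eq_comp, ← inner_sqrt_left]
  exact h

/-- If every `d j` is split off from `t` and the total of the `d j` is at least `α t`, then picking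
`j` with probability proportional to `d j` leaves on average at most `(1 - α / m) t`. -/
lemma sum_normalized_mul_le {m : ℕ} (hm : 0 < m) {d r : Fin m → ℝ≥0∞} {t : ℝ≥0∞} (ht : t ≠ ∞)
    (hadd : ∀ j, r j + d j = t) {α : ℝ} (hα : 0 < α) (hleak : ENNReal.ofReal α * t ≤ ∑ j, d j)
    (h0 : ∑ j, d j ≠ 0) :
    ∑ j, d j * (∑ i, d i)⁻¹ * r j ≤ ENNReal.ofReal (1 - α / m) * t := by
  lift t to NNReal using ht
  have hd : ∀ j, d j ≠ ∞ := fun j => ne_top_of_le_ne_top ENNReal.coe_ne_top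
    (le_add_self.trans_eq (hadd j))
  have hr : ∀ j, r j ≠ ∞ := fun j => ne_top_of_le_ne_top ENNReal.coe_ne_top
    (le_self_add.trans_eq (hadd j))
  obtain ⟨d, rfl⟩ : ∃ d' : Fin m → NNReal, d = fun j => (d' j : ℝ≥0∞) :=
    ⟨fun j => (d j).toNNReal, funext fun j => (ENNReal.coe_toNNReal (hd j)).symm⟩
  obtain ⟨r, rfl⟩ : ∃ r' : Fin m → NNReal, r = fun j => (r' j : ℝ≥0∞) :=
    ⟨fun j => (r j).toNNReal, funext fun j => (ENNReal.coe_toNNReal (hr j)).symm⟩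
  beta_reduce at hadd
  have hrd : ∀ j, (r j : ℝ) = t - d j := fun j => by
    have h : r j + d j = t := by exact_mod_cast hadd j
    rw [← h]
    simp
  set s : NNReal := ∑ j, d j with hs_def
  have hs_coe : ∑ j, (d j : ℝ≥0∞) = s := by rw [hs_def, ENNReal.ofNNReal_finsetSum]
  rw [hs_coe] at h0 hleak ⊢
  have hs_real : ∑ j, (d j : ℝ) = s := by rw [hs_def, NNReal.coe_sum]
  have hs0 : s ≠ 0 := by exact_mod_cast h0
  have hspos : (0 : ℝ) < s := by exact_mod_cast pos_iff_ne_zero.2 hs0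
  have hleak' : α * t ≤ s := by
    have h := ENNReal.toReal_mono ENNReal.coe_ne_top hleak
    simpa [ENNReal.toReal_mul, hα.le] using h
  have hm' : (0 : ℝ) < m := by exact_mod_cast hm
  -- Cauchy–Schwarz over the `m` letters is the source of the factor 1/m in the contraction
  -- constant.
  have hcs : (s : ℝ) ^ 2 ≤ m * ∑ j, (d j : ℝ) ^ 2 := by
    rw [← hs_real]
    simpa using sq_sum_le_card_mul_sum_sq (s := Finset.univ) (f := fun j => (d j : ℝ))
  have hsum : ∑ j, (d j : ℝ) * (s : ℝ)⁻¹ * r j = t - (∑ j, (d j : ℝ) ^ 2) / s := by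
    have : ∀ j, (d j : ℝ) * (s : ℝ)⁻¹ * r j = (t / s) * d j - (d j : ℝ) ^ 2 / s := by
      intro j
      rw [hrd]
      field_simp
    simp only [this]
    rw [Finset.sum_sub_distrib, ← Finset.mul_sum, ← Finset.sum_div, hs_real]
    field_simp
  have hreal : ∑ j, (d j : ℝ) * (s : ℝ)⁻¹ * r j ≤ (1 - α / m) * t := by
    rw [hsum]
    have h1 : s / m ≤ (∑ j, (d j : ℝ) ^ 2) / s := by
      rw [div_le_div_iff₀ hm' hspos]
      nlinarith
    have h2 : α * t / m ≤ s / m := by gcongr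
    have h3 : (1 - α / m) * t = t - α * t / m := by ring
    linarith
  calc ∑ j, (d j : ℝ≥0∞) * (s : ℝ≥0∞)⁻¹ * r j
      = ENNReal.ofReal (∑ j, (d j : ℝ) * (s : ℝ)⁻¹ * r j) := by
        rw [← ENNReal.coe_inv hs0]
        simp only [← ENNReal.coe_mul, ← ENNReal.ofNNReal_finsetSum]
        rw [← ENNReal.ofReal_coe_nnreal]
        push_cast
        rfl
    _ ≤ ENNReal.ofReal ((1 - α / m) * t) := ENNReal.ofReal_le_ofReal hreal
    _ = _ := by rw [ENNReal.ofReal_mul' t.coe_nonneg, ENNReal.ofReal_coe_nnreal]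

/-- The trace of the residual contracts in conditional mean. -/
lemma sum_traceTransition_mul_posTrace_le (hm : 0 < m) (hP : ∀ j, IsStarProjection (P j))
    (hR₀ : R₀.IsPositive) (htr : posTrace R₀ ≠ ∞) {α : ℝ} (hα : 0 < α)
    (hleak : ∀ x ∈ supportSpace R₀, α * ‖x‖ ^ 2 ≤ RCLike.re ⟪x, (∑ j, P j) x⟫_ℂ)
    (q : PMF (Fin m)) (w : List (Fin m)) :
    ∑ j, traceTransition P R₀ q w j * posTrace (residual P R₀ (w ++ [j])) ≤
      ENNReal.ofReal (1 - α / m) * posTrace (residual P R₀ w) := by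
  have hleakw := ofReal_mul_posTrace_residual_le hP hR₀ hα.le hleak w
  have hadd := posTrace_residual_append hP hR₀ w
  have ht := posTrace_residual_ne_top hP hR₀ htr w
  have hd := posTrace_dissipated_ne_top hP hR₀ htr w
  have hs : ∑ j, posTrace (dissipated P R₀ w j) ≠ ∞ := ENNReal.sum_ne_top.2 fun j _ => hd j
  -- If nothing is dissipated, the leakage bound forces the residual trace to be 0, so the fallback
  -- law `q` does not matter.
  by_cases h0 : ∑ j, posTrace (dissipated P R₀ w j) = 0
  · have ht0 : posTrace (residual P R₀ w) = 0 := by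
      rw [h0, nonpos_iff_eq_zero, mul_eq_zero] at hleakw
      exact hleakw.resolve_left (by simpa using hα)
    have hr0 : ∀ j, posTrace (residual P R₀ (w ++ [j])) = 0 := by
      intro j
      have := hadd j
      rw [ht0, add_eq_zero] at this
      exact this.1
    simp [hr0]
  have hcond : ∑' j, posTrace (dissipated P R₀ w j) ≠ 0 ∧
      ∑' j, posTrace (dissipated P R₀ w j) ≠ ∞ := by
    rw [tsum_fintype]
    exact ⟨h0, hs⟩
  rw [traceTransition, dif_pos hcond]
  simp only [PMF.normalize_apply, tsum_fintype]
  exact sum_normalized_mul_le hm ht hadd hα hleakw h0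

/-- Along almost every branch the residual operators tend strongly to zero. -/
theorem ae_tendsto_residual_apply (hm : 0 < m) (hP : ∀ j, IsStarProjection (P j))
    (hR₀ : R₀.IsPositive) (htr : posTrace R₀ ≠ ∞) {α : ℝ} (hα : 0 < α)
    (hleak : ∀ x ∈ supportSpace R₀, α * ‖x‖ ^ 2 ≤ RCLike.re ⟪x, (∑ j, P j) x⟫_ℂ)
    (q : PMF (Fin m)) :
    ∀ᵐ ω ∂(traceMeasure P R₀ q), ∀ x : H, Filter.Tendsto
      (fun n => residual P R₀ (branchPrefix ω n) x) Filter.atTop (nhds 0) := by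
  -- A value α > m, possible when H_0 = 0, is harmless: `ENNReal.ofReal` truncates to 0.
  have hc : ENNReal.ofReal (1 - α / m) < 1 := by
    rw [ENNReal.ofReal_lt_one]
    have : 0 < α / m := div_pos hα (by exact_mod_cast hm)
    linarith
  filter_upwards [ae_tendsto_zero_of_contraction (traceTransition P R₀ q)
    (fun w => posTrace (residual P R₀ w)) htr hc
    (sum_traceTransition_mul_posTrace_le hm hP hR₀ htr hα hleak q)] with ω hω x
  have h1 := ((ENNReal.tendsto_toReal ENNReal.zero_ne_top).comp hω).mul_const ‖x‖
  rw [ENNReal.toReal_zero, zero_mul] at h1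
  exact squeeze_zero_norm (fun n => norm_apply_le_posTrace (residual_isPositive hP hR₀ _)
    (posTrace_residual_ne_top hP hR₀ htr _) x) h1

lemma sum_branchDissipated (hP : ∀ j, IsStarProjection (P j)) (hR₀ : R₀.IsPositive)
    (ω : ℕ → Fin m) (n : ℕ) (x : H) :
    ∑ k ∈ Finset.range n, branchDissipated P R₀ ω k x =
      R₀ x - residual P R₀ (branchPrefix ω n) x := by
  induction n with
  | zero => simp [branchPrefix, residual_nil]
  | succ n ih =>
    rw [Finset.sum_range_succ, ih, branchPrefix_succ, branchDissipated]
    nth_rw 1 [← residual_append_add_dissipated hP hR₀ (branchPrefix ω n) (ω n)]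
    rw [add_apply]
    abel

end Residuals

/-! ### From strong convergence to frame identities for the atoms. -/

section Frames

variable {H : Type*} [NormedAddCommGroup H] [InnerProductSpace ℂ H]

lemma SpectralDecomposition.inner_atom_smul_atom {T : H →L[ℂ] H} (S : SpectralDecomposition T)
    (r : S.index) (x : H) :
    ⟪S.atom r, x⟫_ℂ • S.atom r = ((S.eig r : ℂ) * ⟪S.vec r, x⟫_ℂ) • S.vec r := by
  have h : ((Real.sqrt (S.eig r) : ℝ) : ℂ) * ((Real.sqrt (S.eig r) : ℝ) : ℂ) = (S.eig r : ℂ) := by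
    rw [← Complex.ofReal_mul, Real.mul_self_sqrt (S.eig_nonneg r)]
  rw [SpectralDecomposition.atom, inner_smul_left, smul_smul, Complex.conj_ofReal, ← h]
  congr 1
  ring

lemma SpectralDecomposition.hasSum_inner_atom_smul_atom {T : H →L[ℂ] H}
    (S : SpectralDecomposition T) (x : H) :
    HasSum (fun r => ⟪S.atom r, x⟫_ℂ • S.atom r) (T x) := by
  simp only [S.inner_atom_smul_atom]
  exact S.hasSum_apply x

lemma inner_inner_smul_self (x φ : H) : ⟪x, ⟪φ, x⟫_ℂ • φ⟫_ℂ = ((‖⟪x, φ⟫_ℂ‖ ^ 2 : ℝ) : ℂ) := by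
  rw [inner_smul_right, ← inner_conj_symm φ x, RCLike.conj_mul]
  norm_cast

lemma SpectralDecomposition.hasSum_norm_inner_atom_sq {T : H →L[ℂ] H}
    (S : SpectralDecomposition T) (x : H) :
    HasSum (fun r => ‖⟪x, S.atom r⟫_ℂ‖ ^ 2) (RCLike.re ⟪x, T x⟫_ℂ) := by
  have h := RCLike.hasSum_re ℂ ((S.hasSum_inner_atom_smul_atom x).mapL (innerSL ℂ x))
  simpa only [innerSL_apply_apply, inner_inner_smul_self, RCLike.ofReal_re, RCLike.re_eq_complex_re,
    Complex.ofReal_re] using h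

variable {Δ : ℕ → H →L[ℂ] H} {R : H →L[ℂ] H}

lemma hasSum_re_inner_of_tendsto (hΔ : ∀ k, (Δ k).IsPositive)
    (h : ∀ x, Filter.Tendsto (fun n => ∑ k ∈ Finset.range n, Δ k x) Filter.atTop (nhds (R x)))
    (x : H) : HasSum (fun k => RCLike.re ⟪x, Δ k x⟫_ℂ) (RCLike.re ⟪x, R x⟫_ℂ) := by
  rw [hasSum_iff_tendsto_nat_of_nonneg fun k => (hΔ k).re_inner_nonneg_right x]
  have h1 := (RCLike.continuous_re.tendsto _).comp
    (((innerSL ℂ x).continuous.tendsto _).comp (h x))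
  simpa [Function.comp_def, inner_sum] using h1

lemma hasSum_norm_inner_atom_sq (hΔ : ∀ k, (Δ k).IsPositive)
    (h : ∀ x, Filter.Tendsto (fun n => ∑ k ∈ Finset.range n, Δ k x) Filter.atTop (nhds (R x)))
    (S : ∀ k, SpectralDecomposition (Δ k)) (x : H) :
    HasSum (fun i : (k : ℕ) × (S k).index => ‖⟪x, (S i.1).atom i.2⟫_ℂ‖ ^ 2)
      (RCLike.re ⟪x, R x⟫_ℂ) := by
  have h1 := hasSum_re_inner_of_tendsto hΔ h x
  have h2 := fun k => (S k).hasSum_norm_inner_atom_sq x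
  refine HasSum.sigma_of_hasSum h1 h2 ?_
  refine (summable_sigma_of_nonneg fun i => by positivity).2 ⟨fun k => (h2 k).summable, ?_⟩
  simp only [(h2 _).tsum_eq]
  exact h1.summable

variable [CompleteSpace H]

/-- A family with a finite Bessel bound has square-summable coefficients synthesized
unconditionally. -/
lemma summable_smul_of_bessel {ι : Type*} {φ : ι → H} {B : ℝ} (hB : 0 ≤ B)
    (hφ : ∀ (y : H) (s : Finset ι), ∑ i ∈ s, ‖⟪y, φ i⟫_ℂ‖ ^ 2 ≤ B * ‖y‖ ^ 2) {c : ι → ℂ}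
    (hc : Summable fun i => ‖c i‖ ^ 2) : Summable fun i => c i • φ i := by
  have hbound : ∀ s : Finset ι, ‖∑ i ∈ s, c i • φ i‖ ^ 2 ≤ B * ∑ i ∈ s, ‖c i‖ ^ 2 := by
    intro s
    set v := ∑ i ∈ s, c i • φ i with hv
    -- Duality: pairing `v` with itself lets the Bessel bound be applied to `v`, after which one
    -- factor ‖v‖² cancels.
    have h1 : ‖v‖ ^ 2 ≤ ∑ i ∈ s, ‖c i‖ * ‖⟪v, φ i⟫_ℂ‖ := by
      have : ⟪v, v⟫_ℂ = ∑ i ∈ s, c i * ⟪v, φ i⟫_ℂ := by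
        conv_lhs => rw [hv, inner_sum]
        simp only [inner_smul_right, ← hv]
      have h2 : ‖v‖ ^ 2 = ‖⟪v, v⟫_ℂ‖ := by
        rw [inner_self_eq_norm_sq_to_K]; simp
      rw [h2, this]
      refine (norm_sum_le _ _).trans_eq ?_
      simp
    have h3 := Finset.sum_mul_sq_le_sq_mul_sq s (fun i => ‖c i‖) (fun i => ‖⟪v, φ i⟫_ℂ‖)
    have h4 := hφ v s
    have h5 : (‖v‖ ^ 2) ^ 2 ≤ (∑ i ∈ s, ‖c i‖ ^ 2) * (B * ‖v‖ ^ 2) :=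
      calc (‖v‖ ^ 2) ^ 2 ≤ (∑ i ∈ s, ‖c i‖ * ‖⟪v, φ i⟫_ℂ‖) ^ 2 := by gcongr
        _ ≤ _ := h3
        _ ≤ _ := by gcongr
    rcases (sq_nonneg ‖v‖).eq_or_lt with h0 | h0
    · rw [← h0]; positivity
    · nlinarith
  rw [summable_iff_vanishing_norm]
  intro ε hε
  -- The denominator `B + 1` rather than `B` covers `B = 0`.
  obtain ⟨s, hs⟩ := summable_iff_vanishing_norm.1 hc (ε ^ 2 / (B + 1)) (by positivity)
  refine ⟨s, fun t ht => ?_⟩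
  have h1 := hs t ht
  rw [Real.norm_of_nonneg (by positivity), lt_div_iff₀ (by positivity)] at h1
  have h2 : 0 ≤ ∑ i ∈ t, ‖c i‖ ^ 2 := by positivity
  refine lt_of_pow_lt_pow_left₀ 2 hε.le ?_
  nlinarith [hbound t]

/-- The atoms of a strongly convergent series of positive operators have the sum of the series as
their frame operator. -/
lemma hasSum_inner_atom_smul_atom (hΔ : ∀ k, (Δ k).IsPositive)
    (h : ∀ x, Filter.Tendsto (fun n => ∑ k ∈ Finset.range n, Δ k x) Filter.atTop (nhds (R x)))
    (S : ∀ k, SpectralDecomposition (Δ k)) (x : H) :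
    HasSum (fun i : (k : ℕ) × (S k).index => ⟪(S i.1).atom i.2, x⟫_ℂ • (S i.1).atom i.2)
      (R x) := by
  have hsq := hasSum_norm_inner_atom_sq hΔ h S
  have hsummable : Summable fun i : (k : ℕ) × (S k).index =>
      ⟪(S i.1).atom i.2, x⟫_ℂ • (S i.1).atom i.2 := by
    refine summable_smul_of_bessel (norm_nonneg R) (fun y s => ?_) ?_
    · refine (sum_le_hasSum s (fun i _ => by positivity) (hsq y)).trans ?_
      calc RCLike.re ⟪y, R y⟫_ℂ ≤ ‖⟪y, R y⟫_ℂ‖ := RCLike.re_le_norm _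
        _ ≤ ‖y‖ * ‖R y‖ := norm_inner_le_norm _ _
        _ ≤ ‖y‖ * (‖R‖ * ‖y‖) := by gcongr; exact R.le_opNorm y
        _ = ‖R‖ * ‖y‖ ^ 2 := by ring
    · simpa only [norm_inner_symm] using (hsq x).summable
  obtain ⟨y, hy⟩ := hsummable
  -- The unconditional sum exists; grouping it by level turns it into ∑ Δ_k x, which identifies it
  -- as R x.
  have h1 := (hy.sigma fun k => (S k).hasSum_inner_atom_smul_atom x).tendsto_sum_nat
  rwa [← tendsto_nhds_unique h1 (h x)]

/-- Orthogonal complements agree: y is orthogonal to all atoms exactly when ∑ |⟨y, φ⟩|² = ⟨y, R y⟩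
vanishes. -/
lemma topologicalClosure_span_atom (hΔ : ∀ k, (Δ k).IsPositive) (hR : R.IsPositive)
    (h : ∀ x, Filter.Tendsto (fun n => ∑ k ∈ Finset.range n, Δ k x) Filter.atTop (nhds (R x)))
    (S : ∀ k, SpectralDecomposition (Δ k)) :
    (Submodule.span ℂ (Set.range fun i : (k : ℕ) × (S k).index =>
      (S i.1).atom i.2)).topologicalClosure = supportSpace R := by
  rw [← Submodule.orthogonal_orthogonal_eq_closure, ← supportSpace_orthogonal_orthogonal]
  congr 1
  ext y
  have hsq := hasSum_norm_inner_atom_sq hΔ h S y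
  rw [mem_supportSpace_orthogonal_iff hR, Submodule.mem_orthogonal']
  constructor
  · intro hy
    refine hsq.unique ?_
    convert hasSum_zero with i
    rw [hy _ (Submodule.subset_span ⟨i, rfl⟩)]
    simp
  · intro h0
    rw [h0, hasSum_zero_iff_of_nonneg fun i => by positivity] at hsq
    intro u hu
    induction hu using Submodule.span_induction with
    | mem u hu =>
      obtain ⟨i, rfl⟩ := hu
      simpa using congrFun hsq i
    | zero => simp
    | add u v _ _ hu hv => rw [inner_add_right, hu, hv, add_zero]
    | smul c u _ hu => rw [inner_smul_right, hu, mul_zero]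

lemma isParsevalFrame_atom (hΔ : ∀ k, (Δ k).IsPositive)
    (h : ∀ x, Filter.Tendsto (fun n => ∑ k ∈ Finset.range n, Δ k x) Filter.atTop (nhds (R x)))
    (S : ∀ k, SpectralDecomposition (Δ k)) {K : Submodule ℂ H} (hK : IsClosed (K : Set H))
    (h1 : ∀ x ∈ K, R x = x) (h0 : ∀ x ∈ Kᗮ, R x = 0) :
    IsParsevalFrame K fun i : (k : ℕ) × (S k).index => (S i.1).atom i.2 := by
  have hsq := hasSum_norm_inner_atom_sq hΔ h S
  refine ⟨fun i => ?_, fun x hx => ?_⟩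
  -- As K is closed, K = Kᗮᗮ. For y in Kᗮ the sum of |⟨y, φ⟩|² is ⟨y, R y⟩ = 0, so each atom is
  -- orthogonal to y.
  · rw [← hK.submodule_topologicalClosure_eq, ← Submodule.orthogonal_orthogonal_eq_closure,
      Submodule.mem_orthogonal]
    intro y hy
    have h2 := hsq y
    rw [h0 y hy, inner_zero_right, map_zero, hasSum_zero_iff_of_nonneg fun i => by positivity] at h2
    simpa using congrFun h2 i
  · have h2 := hsq x
    rwa [h1 x hx, inner_self_eq_norm_sq] at h2

end Frames

end

end WRTree

theorem theorem7p3 {H : Type*} [NormedAddCommGroup H] [InnerProductSpace ℂ H] [CompleteSpace H]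
    (m : ℕ) (hm : 2 ≤ m)
    (P : Fin m → H →L[ℂ] H) (hP : ∀ j, IsStarProjection (P j))
    (R₀ : H →L[ℂ] H) (hR₀ : R₀.IsPositive) (htr : WRTree.IsTraceClass R₀)
    (α : ℝ) (hα : 0 < α)
    (hleak : ∀ x ∈ WRTree.supportSpace R₀, α * ‖x‖ ^ 2 ≤ RCLike.re ⟪x, (∑ j, P j) x⟫_ℂ)
    (q : PMF (Fin m)) (hq : ∀ j, q j ≠ 0) :
    (∀ (ω : ℕ → Fin m) (k : ℕ),
      Nonempty (WRTree.SpectralDecomposition (WRTree.branchDissipated P R₀ ω k))) ∧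
    ∀ᵐ ω ∂(WRTree.traceMeasure P R₀ q),
      (∀ x : H, Filter.Tendsto
        (fun n : ℕ => ∑ k ∈ Finset.range n, WRTree.branchDissipated P R₀ ω k x)
        Filter.atTop (nhds (R₀ x))) ∧
      ∀ S : (k : ℕ) → WRTree.SpectralDecomposition (WRTree.branchDissipated P R₀ ω k),
        (∀ x : H,
          HasSum (fun k => ⟪x, WRTree.branchDissipated P R₀ ω k x⟫_ℂ) ⟪x, R₀ x⟫_ℂ ∧
          (∀ k, HasSum (fun r => ‖⟪x, (S k).atom r⟫_ℂ‖ ^ 2)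
            (RCLike.re ⟪x, WRTree.branchDissipated P R₀ ω k x⟫_ℂ)) ∧
          HasSum (fun i : (k : ℕ) × (S k).index => ‖⟪x, (S i.1).atom i.2⟫_ℂ‖ ^ 2)
            (RCLike.re ⟪x, R₀ x⟫_ℂ)) ∧
        (∀ x : H,
          HasSum (fun i : (k : ℕ) × (S k).index => ⟪(S i.1).atom i.2, x⟫_ℂ • (S i.1).atom i.2)
            (R₀ x)) ∧
        (Submodule.span ℂ (Set.range fun i : (k : ℕ) × (S k).index =>
          (S i.1).atom i.2)).topologicalClosure = WRTree.supportSpace R₀ ∧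
        ∀ K : Submodule ℂ H, IsClosed (K : Set H) →
          (∀ x ∈ K, R₀ x = x) → (∀ x ∈ Kᗮ, R₀ x = 0) →
          WRTree.IsParsevalFrame K fun i : (k : ℕ) × (S k).index => (S i.1).atom i.2 := by
  have htr' := htr.posTrace_ne_top hR₀
  have hΔ : ∀ ω k, (WRTree.branchDissipated P R₀ ω k).IsPositive :=
    fun ω k => WRTree.dissipated_isPositive hP _ _
  refine ⟨fun ω k => WRTree.nonempty_spectralDecomposition (hΔ ω k)
    (WRTree.posTrace_dissipated_ne_top hP hR₀ htr' _ _), ?_⟩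
  filter_upwards [WRTree.ae_tendsto_residual_apply (by lia) hP hR₀ htr' hα hleak q] with ω hω
  have hsum : ∀ x : H, Filter.Tendsto
      (fun n : ℕ => ∑ k ∈ Finset.range n, WRTree.branchDissipated P R₀ ω k x)
      Filter.atTop (nhds (R₀ x)) := by
    intro x
    simp only [WRTree.sum_branchDissipated hP hR₀]
    simpa using (hω x).const_sub (R₀ x)
  refine ⟨hsum, fun S => ⟨fun x => ⟨?_, fun k => (S k).hasSum_norm_inner_atom_sq x,
    WRTree.hasSum_norm_inner_atom_sq (hΔ ω) hsum S x⟩,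
    WRTree.hasSum_inner_atom_smul_atom (hΔ ω) hsum S,
    WRTree.topologicalClosure_span_atom (hΔ ω) hR₀ hsum S,
    fun K hK h1 h0 => WRTree.isParsevalFrame_atom (hΔ ω) hsum S hK h1 h0⟩⟩
  -- The remaining complex-valued series has real terms, so it reduces to the real one.
  rw [WRTree.inner_eq_re hR₀]
  convert Complex.hasSum_ofReal.2 (WRTree.hasSum_re_inner_of_tendsto (hΔ ω) hsum x) using 2 with k
  exact WRTree.inner_eq_re (hΔ ω k) x
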